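/- An overpartition is a partition (possibly empty) in which the first occurrence of each part may be overlined; it has distinct parts if its non-overlined parts are pairwise distinct (its overlined parts always are). For an overpartition, or a pair of overpartitions, $\pi$, let $s(\pi)$ denote its smallest part. For a positive integer $n$, consider the pairs $\pi=(\lambda_1,\lambda_2)$ of overpartitions with distinct parts such that the sum of all parts of $\lambda_1$ and $\lambda_2$ is $n$, $s(\pi)=s(\lambda_1)$ occurs overlined in $\lambda_1$, the non-overlined parts of $\lambda_1$ are $>s(\pi)$, the overlined parts of $\lambda_2$ are $>s(\pi)$, and the non-overlined parts of $\lambda_2$ lie in $[s(\pi),2s(\pi))$. Let $A_0(n)$ (resp. $A_1(n)$) be the number of these pairs whose total number of parts is even (resp. odd), and let $A_2(n)$ (resp. $A_3(n)$) be the number of these pairs whose total number of non-overlined parts is even (resp. odd). With $(a;q)_m=\prod_{k=0}^{m-1}(1-aq^k)$ and $(a;q)_\infty=\prod_{k\ge 0}(1-aq^k)$, define integers $A'(n)$ and $A''(n)$ by the formal power series $$\sum_{n\ge 1}A'(n)q^n=\sum_{m\ge 1}q^m(q^{m+1};q)_\infty^3(q^m;q)_m,\qquad \sum_{n\ge 1}A''(n)q^n=\sum_{m\ge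 1}q^m(-q^{m+1};q)_\infty^2(q^{m+1};q)_\infty(q^m;q)_m .$$ Then for every positive integer $n$ that is not a triangular number (not of the form $k(k+1)/2$ with $k\ge 0$ an integer), $A'(n)=A''(n)=0$. Moreover $A_0(n)=A_1(n)$ and $A_2(n)=A_3(n)$ for all such $n$. -/

import Mathlib

noncomputable section

namespace OverpartitionPairs

/-- An overpartition: a partition in which the first occurrence of each part may be overlined.
It is recorded by the set of its overlined parts (each size is overlined at most once) and the
multiset of its non-overlined parts; all parts are positive. -/
@[ext]
structure Overpartition where
  overlined : Finset ℕ
  plain : Multiset ℕ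
  overlined_pos : ∀ i ∈ overlined, 0 < i
  plain_pos : ∀ i ∈ plain, 0 < i

namespace Overpartition

/-- The multiset of all parts, overlined or not. -/
def parts (l : Overpartition) : Multiset ℕ := l.overlined.val + l.plain

/-- The sum of all parts. -/
def size (l : Overpartition) : ℕ := l.parts.sum

/-- The number of parts. -/
def numParts (l : Overpartition) : ℕ := l.parts.card

/-- The overpartition has distinct parts: its non-overlined parts are distinct too. -/
def HasDistinctParts (l : Overpartition) : Prop := l.plain.Nodup

/-- The smallest part. -/
def smallest (l : Overpartition) : ℕ := sInf {i | i ∈ l.parts}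

end Overpartition

/-- An overpartition pair; either component may be empty. -/
abbrev OverpartitionPair := Overpartition × Overpartition

namespace OverpartitionPair

/-- The sum of all parts of both components. -/
def size (p : OverpartitionPair) : ℕ := p.1.size + p.2.size

/-- The number of parts of both components. -/
def numParts (p : OverpartitionPair) : ℕ := p.1.numParts + p.2.numParts

/-- The number of non-overlined parts of both components. -/
def numPlain (p : OverpartitionPair) : ℕ := p.1.plain.card + p.2.plain.card

/-- Both components have distinct parts. -/
def HasDistinctParts (p : OverpartitionPair) : Prop :=
  p.1.HasDistinctParts ∧ p.2.HasDistinctParts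

/-- The smallest part of the pair. -/
def smallest (p : OverpartitionPair) : ℕ := sInf {i | i ∈ p.1.parts + p.2.parts}

end OverpartitionPair

open OverpartitionPair in
/-- The overpartition pairs of `n` counted by `A(n)`. -/
def pairsA (n : ℕ) : Set OverpartitionPair :=
  {p | size p = n ∧ HasDistinctParts p ∧
    smallest p = p.1.smallest ∧ smallest p ∈ p.1.overlined ∧
    (∀ i ∈ p.1.plain, smallest p < i) ∧
    (∀ i ∈ p.2.overlined, smallest p < i) ∧
    (∀ i ∈ p.2.plain, smallest p ≤ i ∧ i < 2 * smallest p)}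

/-- Number of pairs counted by `A(n)` with an even number of parts. -/
def A0 (n : ℕ) : ℕ := {p ∈ pairsA n | Even (OverpartitionPair.numParts p)}.ncard

/-- Number of pairs counted by `A(n)` with an odd number of parts. -/
def A1 (n : ℕ) : ℕ := {p ∈ pairsA n | Odd (OverpartitionPair.numParts p)}.ncard

/-- Number of pairs counted by `A(n)` with an even number of non-overlined parts. -/
def A2 (n : ℕ) : ℕ := {p ∈ pairsA n | Even (OverpartitionPair.numPlain p)}.ncard

/-- Number of pairs counted by `A(n)` with an odd number of non-overlined parts. -/
def A3 (n : ℕ) : ℕ := {p ∈ pairsA n | Odd (OverpartitionPair.numPlain p)}.ncard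

/-- The sets being counted are finite, so that `Set.ncard` is the true cardinality. -/
theorem pairsA_finite (n : ℕ) : (pairsA n).Finite := by
  have hle : ∀ p ∈ pairsA n, ∀ i, (i ∈ p.1.overlined ∨ i ∈ p.1.plain ∨ i ∈ p.2.overlined ∨
      i ∈ p.2.plain) → i ∈ Finset.range (n + 1) := by
    rintro p ⟨hp, -⟩ i hi
    have h1 : ∀ l : Overpartition, (i ∈ l.overlined ∨ i ∈ l.plain) → i ≤ l.size := by
      intro l hl
      apply Multiset.le_sum_of_mem
      simpa [Overpartition.parts] using hl
    have h2 := h1 p.1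
    have h3 := h1 p.2
    simp only [OverpartitionPair.size] at hp
    simp only [Finset.mem_range]
    grind
  let P := (Finset.range (n + 1)).powerset
  refine Set.Finite.of_injOn
    (f := fun p : OverpartitionPair =>
      (p.1.overlined, p.1.plain.toFinset, p.2.overlined, p.2.plain.toFinset))
    (t := ((P ×ˢ P ×ˢ P ×ˢ P : Finset _) : Set _)) ?_ ?_ (Finset.finite_toSet _)
  · intro p hp
    have := hle p hp
    simp only [P, Finset.coe_product, Set.mem_prod, Finset.mem_coe, Finset.mem_powerset]
    refine ⟨fun i hi => this i ?_, fun i hi => this i ?_, fun i hi => this i ?_,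
      fun i hi => this i ?_⟩ <;> try simp only [Multiset.mem_toFinset] at hi
    all_goals tauto
  · rintro p ⟨-, ⟨hp1, hp2⟩, -⟩ r ⟨-, ⟨hr1, hr2⟩, -⟩ h
    simp only [Prod.mk.injEq] at h
    obtain ⟨h1, h2, h3, h4⟩ := h
    have key : ∀ s t : Multiset ℕ, s.Nodup → t.Nodup → s.toFinset = t.toFinset → s = t := by
      intro s t hs ht hst
      have := congrArg Finset.val hst
      rwa [Multiset.toFinset_val, Multiset.toFinset_val, hs.dedup, ht.dedup] at this
    exact Prod.ext (Overpartition.ext h1 (key _ _ hp1 hr1 h2))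
      (Overpartition.ext h3 (key _ _ hp2 hr2 h4))

open PowerSeries
open scoped PowerSeries.WithPiTopology

/-- The finite `q`-shifted factorial `(a; q)_n = ∏_{k < n} (1 - a q ^ k)` in `ℤ⟦q⟧`, `q = X`. -/
def qPoch (a : ℤ⟦X⟧) (n : ℕ) : ℤ⟦X⟧ := ∏ k ∈ Finset.range n, (1 - a * X ^ k)

/-- The infinite `q`-shifted factorial `(a; q)_∞ = ∏_{k ≥ 0} (1 - a q ^ k)` in `ℤ⟦q⟧`, `q = X`. -/
def qPochInf (a : ℤ⟦X⟧) : ℤ⟦X⟧ := ∏' k : ℕ, (1 - a * X ^ k)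

/-- The product defining `(a; q)_∞` converges for every `a`. -/
theorem multipliable_qPochInf (a : ℤ⟦X⟧) : Multipliable fun k : ℕ => 1 - a * (X : ℤ⟦X⟧) ^ k := by
  have := PowerSeries.WithPiTopology.multipliable_one_add_of_tendsto_order_atTop_nhds_top ℤ
    (f := fun k : ℕ => -(a * (X : ℤ⟦X⟧) ^ k)) (by
      refine tendsto_nhds_top_mono ENat.tendsto_natCast_nhds_top (.of_forall fun k => ?_)
      beta_reduce
      rw [order_neg, order_mul, order_X_pow]
      exact le_add_self)
  simpa [sub_eq_add_neg] using this

/-- `q ^ n (q ^ (n + 1); q)_∞ ^ 3 (q ^ n; q)_n` -/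
def termAPrime (n : ℕ) : ℤ⟦X⟧ :=
  X ^ n * qPochInf (X ^ (n + 1)) ^ 3 * qPoch (X ^ n) n

/-- `q ^ n (- q ^ (n + 1); q)_∞ ^ 2 (q ^ (n + 1); q)_∞ (q ^ n; q)_n` -/
def termADoublePrime (n : ℕ) : ℤ⟦X⟧ :=
  X ^ n * qPochInf (-X ^ (n + 1)) ^ 2 * qPochInf (X ^ (n + 1)) * qPoch (X ^ n) n

/-- `A'(n)`: the coefficient of `q ^ n` in `∑_{m ≥ 1} q ^ m (q ^ (m + 1); q)_∞ ^ 3 (q ^ m; q)_m`. -/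
def APrime (n : ℕ) : ℤ := coeff n (∑' m : ℕ, termAPrime (m + 1))

/-- `A''(n)`: the coefficient of `q ^ n` in
`∑_{m ≥ 1} q ^ m (- q ^ (m + 1); q)_∞ ^ 2 (q ^ (m + 1); q)_∞ (q ^ m; q)_m`. -/
def ADoublePrime (n : ℕ) : ℤ := coeff n (∑' m : ℕ, termADoublePrime (m + 1))

/-- The series defining `A'` converges. -/
theorem summable_termAPrime : Summable fun m : ℕ => termAPrime (m + 1) := by
  apply PowerSeries.WithPiTopology.summable_of_tendsto_order_atTop_nhds_top ℤ
  refine tendsto_nhds_top_mono ENat.tendsto_natCast_nhds_top (.of_forall fun k => ?_)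
  beta_reduce
  rw [termAPrime, mul_assoc, order_mul, order_X_pow]
  exact le_add_right (by exact_mod_cast Nat.le_succ k)

/-- The series defining `A''` converges. -/
theorem summable_termADoublePrime : Summable fun m : ℕ => termADoublePrime (m + 1) := by
  apply PowerSeries.WithPiTopology.summable_of_tendsto_order_atTop_nhds_top ℤ
  refine tendsto_nhds_top_mono ENat.tendsto_natCast_nhds_top (.of_forall fun k => ?_)
  beta_reduce
  rw [termADoublePrime, mul_assoc, mul_assoc, order_mul, order_X_pow]
  exact le_add_right (by exact_mod_cast Nat.le_succ k)

end OverpartitionPairs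

end

open PowerSeries
open scoped PowerSeries.WithPiTopology

namespace OverpartitionPairs

/-! Write (a)_m for (a; q)_m. Both series are ∑_m q^m (εq^(m+1))_∞^2 (q^(m+1))_∞ (q^m)_m, with ε = 1
and ε = -1. When ε^2 = 1 this sum equals ∑_{i,j} (-ε)^(i+j) q^((i+j+1)(i+j+2)/2) (`tsum_pairTerm`),
so only triangular exponents occur.

To see this, put m = p + 1, expand the two squared factors by Euler's formula (indices r, s) and the
finite product by the q-binomial theorem (index t). The sum over p is then explicit
(`tsum_gaussBinom`). With i = r + t and j = t + s, the sum over t at fixed i, j is a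
q-Chu–Vandermonde sum equal to q^(ij) (`sum_antidiagonal_gaussBinom`). This factor joins C(i,2) +
C(j,2) into C(i+j,2).

The counts are read off the same products: each factor of the m-th term generates one kind of part
of the pairs with smallest part m. A non-overlined part has weight -1 and an overlined part has
weight -ε (`sum_pairsA_eq`). Thus ε = 1 gives the parity of the number of all parts, and ε = -1 that
of the non-overlined parts; a vanishing signed count means that the two classes are equinumerous. -/

/-- The Gaussian binomial coefficient, as an element of a commutative ring. -/
def gaussBinom {R : Type*} [CommRing R] (q : R) : ℕ → ℕ → R
  | _, 0 => 1
  | 0, _ + 1 => 0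
  | n + 1, k + 1 => gaussBinom q n k + q ^ (k + 1) * gaussBinom q n (k + 1)

/-! ### Gaussian binomials, the q-binomial theorem and q-Chu–Vandermonde -/

section GaussBinom

variable {R : Type*} [CommRing R] (q : R)

@[simp] theorem gaussBinom_zero_right (n : ℕ) : gaussBinom q n 0 = 1 := by
  cases n <;> rfl

theorem gaussBinom_succ_succ (n k : ℕ) : gaussBinom q (n + 1) (k + 1) =
    gaussBinom q n k + q ^ (k + 1) * gaussBinom q n (k + 1) := rfl

theorem gaussBinom_eq_zero : ∀ {n k : ℕ}, n < k → gaussBinom q n k = 0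
  | _, 0, h => by omega
  | 0, _ + 1, _ => rfl
  | n + 1, k + 1, h => by
    rw [gaussBinom_succ_succ, gaussBinom_eq_zero (by omega), gaussBinom_eq_zero (by omega)]
    ring

@[simp] theorem gaussBinom_self (n : ℕ) : gaussBinom q n n = 1 := by
  induction n with
  | zero => simp
  | succ n ih => rw [gaussBinom_succ_succ, ih, gaussBinom_eq_zero q (Nat.lt_succ_self n)]; ring

theorem choose_two_succ (n : ℕ) : (n + 1).choose 2 = n.choose 2 + n := by
  rw [Nat.choose_succ_succ' n 1, Nat.choose_one_right, add_comm]

theorem choose_two_add (a b : ℕ) : (a + b).choose 2 = a.choose 2 + b.choose 2 + a * b := by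
  induction b with
  | zero => simp
  | succ b ih => rw [← add_assoc, choose_two_succ, ih, choose_two_succ]; ring

/-- The finite `q`-binomial theorem. -/
theorem prod_one_sub_eq_sum_gaussBinom (a : R) (n : ℕ) :
    ∏ k ∈ Finset.range n, (1 - a * q ^ k) =
      ∑ t ∈ Finset.range (n + 1), (-a) ^ t * q ^ t.choose 2 * gaussBinom q n t := by
  induction n generalizing a with
  | zero => simp
  | succ n ih =>
    -- The factor k = 0 is split off, so that the induction hypothesis applies with a q in place of
    -- a.
    rw [Finset.prod_range_succ']
    have h : ∀ k, 1 - a * q ^ (k + 1) = 1 - a * q * q ^ k := fun k => by ring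
    simp only [h, ih]
    rw [Finset.sum_range_succ' _ (n + 1)]
    simp only [gaussBinom_succ_succ, choose_two_succ]
    have h1 : ∑ t ∈ Finset.range (n + 1), (-(a * q)) ^ t * q ^ t.choose 2 * gaussBinom q n t =
        ∑ t ∈ Finset.range (n + 1),
          (-(a * q)) ^ (t + 1) * q ^ (t + 1).choose 2 * gaussBinom q n (t + 1) + 1 := by
      have := Finset.sum_range_succ'
        (fun t => (-(a * q)) ^ t * q ^ t.choose 2 * gaussBinom q n t) (n + 1)
      rw [Finset.sum_range_succ, gaussBinom_eq_zero q (Nat.lt_succ_self n)] at this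
      simpa using this
    have h2 : (∑ t ∈ Finset.range (n + 1), (-(a * q)) ^ t * q ^ t.choose 2 * gaussBinom q n t) *
          (1 - a * q ^ 0) =
        (∑ t ∈ Finset.range (n + 1),
          (-(a * q)) ^ (t + 1) * q ^ (t + 1).choose 2 * gaussBinom q n (t + 1) + 1) +
        ∑ t ∈ Finset.range (n + 1), (-a) * ((-(a * q)) ^ t * q ^ t.choose 2 * gaussBinom q n t) := by
      rw [← h1, ← Finset.mul_sum]; ring
    rw [h2, add_right_comm, ← Finset.sum_add_distrib]
    congr 1
    · refine Finset.sum_congr rfl fun t _ => ?_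
      rw [choose_two_succ]
      have h3 : ∀ m, (-(a * q)) ^ m = (-a) ^ m * q ^ m := fun m => by
        rw [← mul_pow]; ring
      rw [h3, h3]
      ring
    · simp

/-- The factorial formula for Gaussian binomials, stated without division so that it holds in any
commutative ring. -/
theorem gaussBinom_mul_prod (t u : ℕ) :
    gaussBinom q (t + u) t * (∏ k ∈ Finset.range t, (1 - q * q ^ k)) *
      (∏ k ∈ Finset.range u, (1 - q * q ^ k)) = ∏ k ∈ Finset.range (t + u), (1 - q * q ^ k) := by
  induction t generalizing u with
  | zero => simp
  | succ t iht =>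
    induction u with
    | zero => simp
    | succ u ihu =>
      have h1 := iht (u + 1)
      rw [show t + 1 + (u + 1) = (t + 1 + u) + 1 by ring, gaussBinom_succ_succ]
      rw [show t + (u + 1) = t + 1 + u by ring] at h1
      rw [Finset.prod_range_succ _ (t + 1 + u), Finset.prod_range_succ _ u] at *
      rw [Finset.prod_range_succ _ t] at *
      -- The recurrence matches 1 - q^(t+u+2) = (1 - q^(t+1)) + q^(t+1) (1 - q^(u+1)).
      linear_combination (1 - q * q ^ t) * h1 + q ^ (t + 1) * (1 - q * q ^ u) * ihu

theorem map_gaussBinom {S : Type*} [CommRing S] (f : R →+* S) :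
    ∀ n k : ℕ, f (gaussBinom q n k) = gaussBinom (f q) n k
  | _, 0 => by simp
  | 0, _ + 1 => by simp [gaussBinom]
  | n + 1, k + 1 => by
    simp [gaussBinom_succ_succ, map_gaussBinom f n k, map_gaussBinom f n (k + 1)]

/-- The generating function `∑ j, [i + j choose i] x ^ j` is the inverse of `(x; q)_{i + 1}`. -/
theorem prod_mul_mk_gaussBinom (i : ℕ) :
    (∏ k ∈ Finset.range (i + 1), (1 - X * C q ^ k)) *
      PowerSeries.mk (fun j => gaussBinom q (i + j) i) = 1 := by
  induction i with
  | zero =>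
    have : PowerSeries.mk (fun j => gaussBinom q (0 + j) 0) = PowerSeries.mk 1 := by
      ext j; simp
    rw [this]
    simpa [mul_comm] using PowerSeries.mk_one_mul_one_sub_eq_one R
  | succ i ih =>
    rw [Finset.prod_range_succ, mul_assoc]
    convert ih using 2
    ext j
    rw [sub_mul, one_mul, map_sub, mul_assoc]
    cases j with
    | zero => simp
    | succ j =>
      rw [coeff_succ_X_mul, ← map_pow, coeff_C_mul, coeff_mk, coeff_mk, coeff_mk,
        show i + 1 + (j + 1) = (i + (j + 1)) + 1 by ring, gaussBinom_succ_succ,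
        show i + 1 + j = i + (j + 1) by ring]
      ring

/-- A form of the `q`-Chu–Vandermonde summation. -/
theorem sum_antidiagonal_gaussBinom (i j : ℕ) :
    ∑ p ∈ Finset.HasAntidiagonal.antidiagonal j, (-1) ^ p.1 * q ^ p.1.choose 2 * gaussBinom q i p.1 *
      gaussBinom q (i + p.2) i = q ^ (i * j) := by
  have hA : ∀ t, coeff t (∏ k ∈ Finset.range i, (1 - (X : R⟦X⟧) * C q ^ k)) =
      (-1) ^ t * q ^ t.choose 2 * gaussBinom q i t := by
    intro t
    rw [prod_one_sub_eq_sum_gaussBinom, map_sum]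
    have : ∀ s, coeff t ((-(X : R⟦X⟧)) ^ s * C q ^ s.choose 2 * gaussBinom (C q) i s) =
        if t = s then (-1) ^ t * q ^ t.choose 2 * gaussBinom q i t else 0 := by
      intro s
      rw [← map_gaussBinom, neg_pow, ← map_pow, mul_assoc, ← map_mul,
        show ((-1 : R⟦X⟧)) ^ s = C ((-1) ^ s) by simp, mul_assoc, coeff_C_mul, mul_comm (X ^ s),
        coeff_C_mul, coeff_X_pow]
      split_ifs with h
      · subst h; ring
      · simp
    simp only [this]
    rw [Finset.sum_ite_eq]
    split_ifs with h
    · rfl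
    · rw [gaussBinom_eq_zero q (by simpa using h)]; simp
  -- The first i of the i + 1 factors inverted by `prod_mul_mk_gaussBinom` leave the geometric
  -- series 1/(1 - x q^i). The claim compares coefficients of x^j.
  have hB : (∏ k ∈ Finset.range i, (1 - (X : R⟦X⟧) * C q ^ k)) *
      PowerSeries.mk (fun j => gaussBinom q (i + j) i) = PowerSeries.mk (fun j => q ^ (i * j)) := by
    have h1 := prod_mul_mk_gaussBinom q i
    have h2 : (1 - X * C q ^ i) * PowerSeries.mk (fun j => q ^ (i * j)) = 1 := by
      ext j
      rw [sub_mul, one_mul, map_sub, mul_assoc]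
      cases j with
      | zero => simp
      | succ j =>
        rw [coeff_succ_X_mul, ← map_pow, coeff_C_mul, coeff_mk, coeff_mk, coeff_one]
        simp; ring
    rw [Finset.prod_range_succ] at h1
    linear_combination (PowerSeries.mk (fun j => q ^ (i * j))) * h1 -
      (∏ k ∈ Finset.range i, (1 - (X : R⟦X⟧) * C q ^ k)) *
      PowerSeries.mk (fun j => gaussBinom q (i + j) i) * h2
  have := congrArg (coeff j) hB
  rw [coeff_mul, coeff_mk] at this
  simpa only [hA, coeff_mk] using this

end GaussBinom

/-! ### X-adic convergence -/

section Convergence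

theorem summable_of_X_pow_dvd {ι : Type*} {f : ι → ℤ⟦X⟧} (e : ι → ℕ)
    (he : ∀ d, {i | e i ≤ d}.Finite) (h : ∀ i, X ^ e i ∣ f i) : Summable f := by
  rw [PowerSeries.WithPiTopology.summable_iff_summable_coeff]
  intro d
  refine summable_of_hasFiniteSupport ((he d).subset fun i hi => ?_)
  by_contra hlt
  exact hi (X_pow_dvd_iff.mp (h i) d (by simpa using hlt))

theorem tendsto_one_of_X_pow_dvd {u : ℕ → ℤ⟦X⟧} (h : ∀ N, X ^ N ∣ u N - 1) :
    Filter.Tendsto u Filter.atTop (nhds 1) := by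
  rw [PowerSeries.WithPiTopology.tendsto_iff_coeff_tendsto]
  intro d
  refine tendsto_const_nhds.congr' ?_
  filter_upwards [Filter.eventually_gt_atTop d] with N hN
  have := X_pow_dvd_iff.mp (h N) d hN
  rw [map_sub] at this
  linarith

theorem X_pow_dvd_tsum {ι : Type*} {f : ι → ℤ⟦X⟧} {N : ℕ} (h : ∀ i, X ^ N ∣ f i) :
    X ^ N ∣ ∑' i, f i := by
  by_cases hf : Summable f
  · rw [X_pow_dvd_iff]
    intro d hd
    have := (PowerSeries.WithPiTopology.hasSum_iff_hasSum_coeff ℤ).mp hf.hasSum d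
    rw [← this.tsum_eq]
    simp [fun i => X_pow_dvd_iff.mp (h i) d hd]
  · rw [tsum_eq_zero_of_not_summable hf]
    exact dvd_zero _

theorem coeff_tsum {ι : Type*} {f : ι → ℤ⟦X⟧} (hf : Summable f) (n : ℕ) :
    coeff n (∑' i, f i) = ∑' i, coeff n (f i) :=
  ((PowerSeries.WithPiTopology.hasSum_iff_hasSum_coeff ℤ).mp hf.hasSum n).tsum_eq.symm

end Convergence

/-! ### Infinite q-products and Euler's expansions -/

section QPochhammer

theorem qPoch_succ (a : ℤ⟦X⟧) (n : ℕ) : qPoch a (n + 1) = qPoch a n * (1 - a * X ^ n) :=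
  Finset.prod_range_succ _ _

theorem qPoch_succ' (a : ℤ⟦X⟧) (n : ℕ) : qPoch a (n + 1) = (1 - a) * qPoch (a * X) n := by
  rw [qPoch, Finset.prod_range_succ', qPoch, mul_comm]
  congr 1
  · simp
  · exact Finset.prod_congr rfl fun k _ => by ring

theorem qPoch_mul_qPochInf (a : ℤ⟦X⟧) (n : ℕ) :
    qPoch a n * qPochInf (a * X ^ n) = qPochInf a := by
  rw [qPoch, qPochInf, qPochInf]
  have h : ∀ k, 1 - a * X ^ n * X ^ k = 1 - a * X ^ (k + n) := fun k => by ring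
  have hm := multipliable_qPochInf (a * X ^ n)
  simp only [h] at hm ⊢
  have := Multipliable.prod_mul_tprod_nat_mul' (f := fun k => 1 - a * (X : ℤ⟦X⟧) ^ k) (k := n) hm
  exact this

theorem tendsto_qPoch (a : ℤ⟦X⟧) :
    Filter.Tendsto (qPoch a) Filter.atTop (nhds (qPochInf a)) := by
  have h := (multipliable_qPochInf a).hasProd.tendsto_prod_nat
  unfold qPochInf qPoch
  exact h

/-- The inverse of `(q; q)_n`. -/
noncomputable def invPoch (n : ℕ) : ℤ⟦X⟧ := invOfUnit (qPoch X n) 1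

theorem qPoch_mul_invPoch (n : ℕ) : qPoch X n * invPoch n = 1 := by
  apply mul_invOfUnit
  simp [qPoch]

@[simp] theorem invPoch_zero : invPoch 0 = 1 := by
  simpa [qPoch] using qPoch_mul_invPoch 0

theorem one_sub_mul_invPoch_succ (n : ℕ) : (1 - X ^ (n + 1)) * invPoch (n + 1) = invPoch n := by
  have h1 := qPoch_mul_invPoch n
  have h2 := qPoch_mul_invPoch (n + 1)
  rw [qPoch_succ] at h2
  linear_combination invPoch n * h2 - (1 - X ^ (n + 1)) * invPoch (n + 1) * h1

theorem gaussBinom_eq (t u : ℕ) :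
    gaussBinom X (t + u) t = qPoch X (t + u) * invPoch t * invPoch u := by
  have h := gaussBinom_mul_prod (X : ℤ⟦X⟧) t u
  change _ * qPoch X t * qPoch X u = qPoch X (t + u) at h
  have h1 := qPoch_mul_invPoch t
  have h2 := qPoch_mul_invPoch u
  rw [← h]
  linear_combination (-gaussBinom X (t + u) t) * (h1 + h2 * (qPoch X t * invPoch t))

/-- The general term of Euler's expansion of `(a; q)_∞`. -/
noncomputable def eulerTerm (a : ℤ⟦X⟧) (r : ℕ) : ℤ⟦X⟧ := (-a) ^ r * X ^ r.choose 2 * invPoch r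

theorem summable_eulerTerm (a : ℤ⟦X⟧) : Summable (eulerTerm a) := by
  refine summable_of_X_pow_dvd (fun r => r.choose 2) (fun d => ?_) fun r =>
    Dvd.dvd.mul_right (dvd_mul_left _ _) _
  refine (Set.finite_Iic (d + 1)).subset fun r hr => ?_
  rcases r with _ | r
  · simp
  · simp only [Set.mem_ofPred_eq, choose_two_succ] at hr
    simp only [Set.mem_Iic]
    omega

/-- Subtracting the two series termwise leaves a factor 1 - q^r, which cancels against the last
factor of (q)_r and shifts the index. Iterating this functional equation yields the product (a)_∞.
-/
theorem tsum_eulerTerm_eq_mul (a : ℤ⟦X⟧) :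
    ∑' r, eulerTerm a r = (1 - a) * ∑' r, eulerTerm (a * X) r := by
  have h1 := (summable_eulerTerm a).sub (summable_eulerTerm (a * X))
  have h2 : ∑' r, (eulerTerm a r - eulerTerm (a * X) r) = -a * ∑' r, eulerTerm (a * X) r := by
    rw [h1.tsum_eq_zero_add, ← (summable_eulerTerm (a * X)).tsum_mul_left]
    have h0 : eulerTerm a 0 - eulerTerm (a * X) 0 = 0 := by simp [eulerTerm]
    rw [h0, zero_add]
    refine tsum_congr fun r => ?_
    simp only [eulerTerm, ← one_sub_mul_invPoch_succ r, choose_two_succ]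
    rw [neg_pow a (r + 1), neg_pow (a * X) (r + 1), neg_pow (a * X) r]
    ring
  rw [(summable_eulerTerm a).tsum_sub (summable_eulerTerm (a * X))] at h2
  linear_combination h2

/-- Euler's expansion of `(a; q)_∞`. -/
theorem tsum_eulerTerm (a : ℤ⟦X⟧) : ∑' r, eulerTerm a r = qPochInf a := by
  have h : ∀ n, ∑' r, eulerTerm a r = qPoch a n * ∑' r, eulerTerm (a * X ^ n) r := by
    intro n
    induction n with
    | zero => simp [qPoch]
    | succ n ih =>
      rw [ih, tsum_eulerTerm_eq_mul (a * X ^ n), qPoch_succ, mul_assoc, mul_assoc, pow_succ]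
  have h1 : Filter.Tendsto (fun n => ∑' r, eulerTerm (a * X ^ n) r) Filter.atTop (nhds 1) := by
    refine tendsto_one_of_X_pow_dvd fun n => ?_
    rw [(summable_eulerTerm _).tsum_eq_zero_add]
    have h0 : eulerTerm (a * X ^ n) 0 = 1 := by simp [eulerTerm]
    rw [h0, add_sub_cancel_left]
    refine X_pow_dvd_tsum fun r => ?_
    refine Dvd.dvd.mul_right (Dvd.dvd.mul_right ?_ _) _
    rw [pow_succ, neg_mul_eq_neg_mul]
    exact Dvd.dvd.mul_left (dvd_mul_left _ _) _
  have h2 := (tendsto_qPoch a).mul h1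
  simp only [← h, mul_one] at h2
  exact tendsto_nhds_unique tendsto_const_nhds h2

theorem summable_X_pow_mul_invPoch (k : ℕ) :
    Summable fun u : ℕ => X ^ (u * (k + 1)) * invPoch u := by
  refine summable_of_X_pow_dvd (fun u => u * (k + 1)) (fun d => ?_) fun u => dvd_mul_right _ _
  exact (Set.finite_Iic d).subset fun u hu => (Nat.le_mul_of_pos_right u k.succ_pos).trans hu

/-- The sum H(k) is Euler's expansion of 1/(q^(k+1))_∞. Termwise subtraction gives H(k+1) = (1 -
q^(k+1)) H(k), so H(k) = (q)_k H(0); since H(k) tends to 1, (q)_∞ H(0) = 1. -/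
theorem qPochInf_mul_tsum_invPoch (k : ℕ) :
    qPochInf X * ∑' u : ℕ, X ^ (u * (k + 1)) * invPoch u = qPoch X k := by
  set H : ℕ → ℤ⟦X⟧ := fun k => ∑' u : ℕ, X ^ (u * (k + 1)) * invPoch u with hH
  have hstep : ∀ k, H (k + 1) = (1 - X ^ (k + 1)) * H k := by
    intro k
    have h1 := (summable_X_pow_mul_invPoch k).sub (summable_X_pow_mul_invPoch (k + 1))
    have h2 : ∑' u : ℕ, (X ^ (u * (k + 1)) * invPoch u - X ^ (u * (k + 1 + 1)) * invPoch u) =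
        X ^ (k + 1) * H k := by
      rw [h1.tsum_eq_zero_add, hH, ← (summable_X_pow_mul_invPoch k).tsum_mul_left]
      simp only [zero_mul, sub_self, zero_add]
      refine tsum_congr fun u => ?_
      rw [← one_sub_mul_invPoch_succ u]
      ring
    rw [(summable_X_pow_mul_invPoch k).tsum_sub (summable_X_pow_mul_invPoch (k + 1))] at h2
    linear_combination -h2
  have hprod : ∀ k, H k = qPoch X k * H 0 := by
    intro k
    induction k with
    | zero => simp [qPoch]
    | succ k ih => rw [hstep, ih, qPoch_succ]; ring
  have h1 : Filter.Tendsto H Filter.atTop (nhds 1) := by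
    refine tendsto_one_of_X_pow_dvd fun n => ?_
    rw [hH]
    dsimp only
    rw [(summable_X_pow_mul_invPoch n).tsum_eq_zero_add]
    simp only [zero_mul, pow_zero, invPoch_zero, mul_one, add_sub_cancel_left]
    exact X_pow_dvd_tsum fun u => Dvd.dvd.mul_right (pow_dvd_pow _ (by nlinarith)) _
  have h2 := (tendsto_qPoch X).mul_const (H 0)
  simp only [← hprod] at h2
  change qPochInf X * H k = _
  rw [hprod k, mul_left_comm, tendsto_nhds_unique h2 h1, mul_one]

/-- Terms with p < t vanish. For p = t + u, the factor (q)_p of the Gaussian binomial completes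
(q^(p+1))_∞ to (q)_∞, leaving the series of `qPochInf_mul_tsum_invPoch` in u. -/
theorem tsum_gaussBinom (k t : ℕ) :
    ∑' p : ℕ, X ^ (p * (k + 1)) * qPochInf (X ^ (p + 1)) * gaussBinom X p t =
      invPoch t * X ^ (t * (k + 1)) * qPoch X k := by
  have hinj : Function.Injective fun u : ℕ => t + u := add_right_injective t
  rw [← hinj.tsum_eq, ← qPochInf_mul_tsum_invPoch k]
  · rw [← mul_assoc, ← (summable_X_pow_mul_invPoch k).tsum_mul_left]
    refine tsum_congr fun u => ?_
    have h := qPoch_mul_qPochInf X (t + u)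
    rw [gaussBinom_eq, ← h, ← pow_succ']
    ring
  · intro p hp
    by_contra hlt
    apply hp
    have : p < t := by
      by_contra hle
      exact hlt ⟨p - t, by dsimp only; omega⟩
    simp [gaussBinom_eq_zero _ this]

end QPochhammer

/-! ### Evaluation of the common series -/

section MainSeries

variable (ε : ℤ⟦X⟧)

/-- The common form of the terms of the two series, which are the cases `ε = 1` and `ε = -1`. -/
noncomputable def pairTerm (m : ℕ) : ℤ⟦X⟧ :=
  X ^ m * qPochInf (ε * X ^ (m + 1)) ^ 2 * qPochInf (X ^ (m + 1)) * qPoch (X ^ m) m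

/-- The factor 1 - q^(p+1) moves from the finite product to the infinite one. The latter becomes
(q^(p+1))_∞, as the sum over p requires, and the finite one gets length p. -/
theorem pairTerm_succ (p : ℕ) : pairTerm ε (p + 1) =
    X ^ (p + 1) * qPochInf (ε * X ^ (p + 2)) ^ 2 * qPochInf (X ^ (p + 1)) *
      qPoch (X ^ (p + 2)) p := by
  have h := qPoch_mul_qPochInf (X ^ (p + 1)) 1
  have h1 : qPoch (X ^ (p + 1)) 1 = 1 - X ^ (p + 1) := by simp [qPoch]
  rw [h1, ← pow_add] at h
  rw [pairTerm, qPoch_succ', ← pow_succ, ← h]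
  ring

/-- The general term of the expansion of `pairTerm ε (p + 1)`. -/
noncomputable def expansionTerm (x : ℕ × ℕ × ℕ) (p : ℕ) : ℤ⟦X⟧ :=
  X ^ (p + 1) * qPochInf (X ^ (p + 1)) * eulerTerm (ε * X ^ (p + 2)) x.1 *
    ((-X ^ (p + 2)) ^ x.2.1 * X ^ x.2.1.choose 2 * gaussBinom X p x.2.1) *
    eulerTerm (ε * X ^ (p + 2)) x.2.2

theorem finite_triple (d : ℕ) : {x : ℕ × ℕ × ℕ | x.1 + x.2.1 + x.2.2 ≤ d}.Finite := by
  refine ((Finset.range (d + 1) ×ˢ Finset.range (d + 1) ×ˢ Finset.range (d + 1)).finite_toSet).subset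
    fun x hx => ?_
  simp only [Set.mem_ofPred_eq] at hx
  simp only [Finset.coe_product, Set.mem_prod, Finset.coe_range, Set.mem_Iio]
  omega

theorem X_pow_dvd_neg_mul_pow (a : ℤ⟦X⟧) (p r : ℕ) : X ^ r ∣ (-(a * X ^ (p + 2))) ^ r := by
  refine pow_dvd_pow_of_dvd ?_ r
  rw [pow_succ, neg_mul_eq_neg_mul, ← mul_assoc]
  exact dvd_mul_left _ _

theorem X_pow_dvd_expansionTerm (x : ℕ × ℕ × ℕ) (p : ℕ) :
    X ^ (p + (x.1 + x.2.1 + x.2.2)) ∣ expansionTerm ε x p := by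
  have h1 : (X : ℤ⟦X⟧) ^ p ∣ X ^ (p + 1) * qPochInf (X ^ (p + 1)) :=
    Dvd.dvd.mul_right (pow_dvd_pow _ p.le_succ) _
  have h2 : ∀ r, X ^ r ∣ eulerTerm (ε * X ^ (p + 2)) r := fun r =>
    Dvd.dvd.mul_right (Dvd.dvd.mul_right (X_pow_dvd_neg_mul_pow ε p r) _) _
  have h3 : ∀ t, X ^ t ∣ (-(X : ℤ⟦X⟧) ^ (p + 2)) ^ t * X ^ t.choose 2 * gaussBinom X p t := fun t =>
    Dvd.dvd.mul_right (Dvd.dvd.mul_right (by simpa using X_pow_dvd_neg_mul_pow 1 p t) _) _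
  rw [pow_add, pow_add, pow_add, expansionTerm, ← mul_assoc, ← mul_assoc]
  exact mul_dvd_mul (mul_dvd_mul (mul_dvd_mul h1 (h2 _)) (h3 _)) (h2 _)

theorem summable_expansionTerm : Summable fun y : (ℕ × ℕ × ℕ) × ℕ => expansionTerm ε y.1 y.2 := by
  refine summable_of_X_pow_dvd (fun y => y.2 + (y.1.1 + y.1.2.1 + y.1.2.2)) (fun d => ?_)
    fun y => X_pow_dvd_expansionTerm ε y.1 y.2
  refine ((finite_triple d).prod (Set.finite_Iic d)).subset fun y hy => ?_
  simp only [Set.mem_ofPred_eq] at hy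
  simp only [Set.mem_prod, Set.mem_ofPred_eq, Set.mem_Iic]
  omega

theorem tsum_qPoch_term (p : ℕ) :
    ∑' t : ℕ, (-X ^ (p + 2)) ^ t * X ^ t.choose 2 * gaussBinom X p t =
      qPoch (X ^ (p + 2)) p := by
  rw [qPoch, prod_one_sub_eq_sum_gaussBinom]
  refine tsum_eq_sum fun t ht => ?_
  rw [gaussBinom_eq_zero _ (by simpa using ht), mul_zero]

theorem summable_qPoch_term (p : ℕ) :
    Summable fun t : ℕ => (-(X : ℤ⟦X⟧) ^ (p + 2)) ^ t * X ^ t.choose 2 * gaussBinom X p t := by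
  refine summable_of_ne_finset_zero (s := Finset.range (p + 1)) fun t ht => ?_
  rw [gaussBinom_eq_zero _ (by simpa using ht), mul_zero]

theorem pairTerm_succ_eq_tsum (p : ℕ) :
    pairTerm ε (p + 1) = ∑' x : ℕ × ℕ × ℕ, expansionTerm ε x p := by
  have hs : Summable fun x : ℕ × ℕ × ℕ => expansionTerm ε x p :=
    (summable_expansionTerm ε).prod_symm.prod_factor p
  rw [hs.tsum_prod]
  have h2 : ∀ r, ∑' y : ℕ × ℕ, expansionTerm ε (r, y) p =
      eulerTerm (ε * X ^ (p + 2)) r * (X ^ (p + 1) * qPochInf (X ^ (p + 1)) *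
        qPoch (X ^ (p + 2)) p * qPochInf (ε * X ^ (p + 2))) := by
    intro r
    rw [(hs.prod_factor r).tsum_prod]
    have h3 : ∀ t, ∑' s, expansionTerm ε (r, t, s) p =
        ((-X ^ (p + 2)) ^ t * X ^ t.choose 2 * gaussBinom X p t) *
        (X ^ (p + 1) * qPochInf (X ^ (p + 1)) * eulerTerm (ε * X ^ (p + 2)) r *
        qPochInf (ε * X ^ (p + 2))) := by
      intro t
      simp only [expansionTerm]
      rw [(summable_eulerTerm _).tsum_mul_left, tsum_eulerTerm]
      ring
    simp only [h3]
    rw [(summable_qPoch_term p).tsum_mul_right, tsum_qPoch_term]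
    ring
  simp only [h2]
  rw [(summable_eulerTerm _).tsum_mul_right, tsum_eulerTerm, pairTerm_succ]
  ring

/-- The monomial at `(i, j)` of the expansion of the main series, before the factor `q ^ (i j)`. -/
noncomputable def monomialTerm (i j : ℕ) : ℤ⟦X⟧ :=
  X * (-ε) ^ (i + j) * X ^ (2 * (i + j) + i.choose 2 + j.choose 2)

/-- The general term of the main series after summation over `p`. -/
noncomputable def reducedTerm (i : ℕ) (y : ℕ × ℕ) : ℤ⟦X⟧ :=
  ((-1) ^ y.1 * X ^ y.1.choose 2 * gaussBinom X i y.1 * gaussBinom X (i + y.2) i) *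
    monomialTerm ε i (y.1 + y.2)

variable {ε}

theorem tsum_expansionTerm (hε : ε ^ 2 = 1) (r t s : ℕ) :
    ∑' p, expansionTerm ε (r, t, s) p = reducedTerm ε (r + t) (t, s) := by
  have h1 : ∀ p, expansionTerm ε (r, t, s) p =
      (X * (-(ε * X ^ 2)) ^ (r + s) * X ^ (r.choose 2 + s.choose 2) * (-X ^ 2) ^ t *
        X ^ t.choose 2 * invPoch r * invPoch s) *
      (X ^ (p * (r + t + s + 1)) * qPochInf (X ^ (p + 1)) * gaussBinom X p t) := by
    intro p
    simp only [expansionTerm, eulerTerm]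
    have e1 : ∀ k, (-(ε * (X : ℤ⟦X⟧) ^ (p + 2))) ^ k = (-(ε * X ^ 2)) ^ k * X ^ (p * k) := by
      intro k; rw [pow_mul, ← mul_pow]; ring
    have e2 : ∀ k, (-(X : ℤ⟦X⟧) ^ (p + 2)) ^ k = (-X ^ 2) ^ k * X ^ (p * k) := by
      intro k; rw [pow_mul, ← mul_pow]; ring
    rw [e1, e1, e2]
    ring
  have hs : Summable fun p : ℕ => X ^ (p * (r + t + s + 1)) * qPochInf (X ^ (p + 1)) *
      gaussBinom X p t := by
    refine summable_of_X_pow_dvd (fun p => p * (r + t + s + 1)) (fun d => ?_) fun p =>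
      Dvd.dvd.mul_right (dvd_mul_right _ _) _
    exact (Set.finite_Iic d).subset fun u hu => (Nat.le_mul_of_pos_right u (Nat.succ_pos _)).trans hu
  simp only [h1]
  rw [hs.tsum_mul_left, tsum_gaussBinom]
  simp only [reducedTerm, monomialTerm]
  have g1 : gaussBinom (X : ℤ⟦X⟧) (r + t) t = qPoch X (r + t) * invPoch t * invPoch r := by
    rw [add_comm r t]; exact gaussBinom_eq t r
  rw [g1, gaussBinom_eq (r + t) s]
  have h3 := qPoch_mul_invPoch (r + t)
  -- Here i + j = r + s + 2t, so ε^2 = 1 makes the sign depend on i + j alone.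
  have e3 : (-ε) ^ (r + t + (t + s)) = (-ε) ^ (r + s) := by
    rw [show r + t + (t + s) = r + s + 2 * t by ring, pow_add, pow_mul, neg_sq, hε, one_pow, mul_one]
  have e4 : ∀ k, (-(ε * (X : ℤ⟦X⟧) ^ 2)) ^ k = (-ε) ^ k * X ^ (2 * k) := by
    intro k; rw [pow_mul, ← mul_pow]; ring
  have e5 : (-(X : ℤ⟦X⟧) ^ 2) ^ t = (-1) ^ t * X ^ (2 * t) := by
    rw [pow_mul, ← mul_pow]; ring
  -- From t^2 = 2 C(t,2) + t; the pieces rebuild C(r+t,2) and C(t+s,2).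
  have e6 : t * (r + t + s + 1) = r * t + t * s + t.choose 2 + t.choose 2 + t + t := by
    have h := choose_two_add t t
    have h2 : ∀ t : ℕ, t * t = t.choose 2 + t.choose 2 + t := by
      intro t
      induction t with
      | zero => simp
      | succ t ih => rw [choose_two_succ]; nlinarith
    nlinarith [h2 t]
  rw [e3, e4, e5, e6, choose_two_add r t, choose_two_add t s]
  linear_combination (-(X * (-ε) ^ (r + s) * X ^ (2 * (r + t + (t + s)) + (r.choose 2 + t.choose 2
    + r * t) + (t.choose 2 + s.choose 2 + t * s)) * (-1) ^ t * X ^ t.choose 2 *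
    invPoch t * invPoch r * qPoch X (r + t + s) * invPoch s)) * h3

theorem summable_reducedTerm (ε : ℤ⟦X⟧) :
    Summable fun x : ℕ × ℕ × ℕ => reducedTerm ε x.1 x.2 := by
  refine summable_of_X_pow_dvd (fun x => x.1 + x.2.1 + x.2.2) finite_triple fun x => ?_
  refine Dvd.dvd.mul_left (Dvd.dvd.mul_left (pow_dvd_pow _ ?_) _) _
  omega

theorem tsum_pairTerm (hε : ε ^ 2 = 1) :
    ∑' p, pairTerm ε (p + 1) =
      ∑' (i : ℕ) (j : ℕ), X * (-ε) ^ (i + j) * X ^ (2 * (i + j) + (i + j).choose 2) := by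
  have hS := summable_expansionTerm ε
  simp only [pairTerm_succ_eq_tsum]
  rw [Summable.tsum_comm (f := fun x p => expansionTerm ε x p) hS]
  have h1 : ∀ x : ℕ × ℕ × ℕ, ∑' p, expansionTerm ε x p =
      reducedTerm ε (x.1 + x.2.1) x.2 := fun x => tsum_expansionTerm hε x.1 x.2.1 x.2.2
  simp only [h1]
  -- The triples (r, t, s) become triples (i, t, s) with t ≤ i; the remaining triples contribute
  -- nothing because the Gaussian binomial of i over t vanishes.
  have hinj : Function.Injective fun x : ℕ × ℕ × ℕ => (x.1 + x.2.1, x.2) := by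
    rintro ⟨r, t, s⟩ ⟨r', t', s'⟩ h
    simp only [Prod.mk.injEq] at h ⊢
    omega
  rw [hinj.tsum_eq (f := fun x : ℕ × ℕ × ℕ => reducedTerm ε x.1 x.2)]
  · rw [(summable_reducedTerm ε).tsum_prod]
    refine tsum_congr fun i => ?_
    have hi : Summable fun y : ℕ × ℕ => reducedTerm ε i y := (summable_reducedTerm ε).prod_factor i
    -- Grouping (t, s) by j = t + s makes the monomial constant on each finite group.
    rw [← Finset.HasAntidiagonal.sigmaAntidiagonalEquivProd.tsum_eq (reducedTerm ε i)]
    refine Eq.trans ((Finset.HasAntidiagonal.sigmaAntidiagonalEquivProd (A := ℕ)).summable_iff.mpr hi).tsum_sigma ?_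
    refine tsum_congr fun j => ?_
    rw [tsum_fintype]
    have h2 := Finset.sum_coe_sort (Finset.HasAntidiagonal.antidiagonal j) (reducedTerm ε i)
    refine h2.trans ?_
    have h3 : ∀ y ∈ Finset.HasAntidiagonal.antidiagonal j, reducedTerm ε i y =
        ((-1) ^ y.1 * X ^ y.1.choose 2 * gaussBinom X i y.1 * gaussBinom X (i + y.2) i) *
          monomialTerm ε i j := by
      intro y hy
      rw [Finset.HasAntidiagonal.mem_antidiagonal] at hy
      rw [reducedTerm, hy]
    rw [Finset.sum_congr rfl h3, ← Finset.sum_mul, sum_antidiagonal_gaussBinom, monomialTerm,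
      choose_two_add]
    ring
  · rintro ⟨i, t, s⟩ hx
    by_contra hlt
    apply hx
    have : i < t := by
      by_contra hle
      exact hlt ⟨(i - t, t, s), Prod.ext (Nat.sub_add_cancel (not_lt.mp hle)) rfl⟩
    simp [reducedTerm, gaussBinom_eq_zero _ this]

theorem coeff_tsum_pairTerm (u : ℤ) (hu : u ^ 2 = 1) {n : ℕ}
    (htri : ¬ ∃ k : ℕ, n = k * (k + 1) / 2) :
    coeff n (∑' p, pairTerm (C u) (p + 1)) = 0 := by
  have hε : (C u : ℤ⟦X⟧) ^ 2 = 1 := by rw [← map_pow, hu, map_one]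
  have hsum : Summable fun y : ℕ × ℕ =>
      (X : ℤ⟦X⟧) * (-C u) ^ (y.1 + y.2) * X ^ (2 * (y.1 + y.2) + (y.1 + y.2).choose 2) := by
    refine summable_of_X_pow_dvd (fun y => y.1 + y.2) (fun d => ?_) fun y =>
      Dvd.dvd.mul_left (pow_dvd_pow _ (by omega)) _
    refine ((Set.finite_Iic d).prod (Set.finite_Iic d)).subset fun y hy => ?_
    simp only [Set.mem_ofPred_eq] at hy
    simp only [Set.mem_prod, Set.mem_Iic]
    omega
  rw [tsum_pairTerm hε, ← hsum.tsum_prod (f := fun y : ℕ × ℕ =>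
      (X : ℤ⟦X⟧) * (-C u) ^ (y.1 + y.2) * X ^ (2 * (y.1 + y.2) + (y.1 + y.2).choose 2)),
    coeff_tsum hsum]
  refine (tsum_congr fun y => ?_).trans tsum_zero
  have h1 : (X : ℤ⟦X⟧) * (-C u) ^ (y.1 + y.2) * X ^ (2 * (y.1 + y.2) + (y.1 + y.2).choose 2) =
      C ((-u) ^ (y.1 + y.2)) * X ^ (2 * (y.1 + y.2) + (y.1 + y.2).choose 2 + 1) := by
    rw [map_pow, map_neg]; ring
  rw [h1, coeff_C_mul, coeff_X_pow, if_neg, mul_zero]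
  intro hn
  apply htri
  -- With N = i + j, the exponent 1 + 2N + C(N,2) equals C(N+2,2) = (N+1)(N+2)/2.
  refine ⟨y.1 + y.2 + 1, ?_⟩
  have h2 := Nat.choose_two_right (y.1 + y.2 + 1 + 1)
  rw [choose_two_succ, choose_two_succ] at h2
  rw [Nat.add_sub_cancel, mul_comm] at h2
  rw [← h2, hn]
  ring

theorem termAPrime_eq (m : ℕ) : termAPrime m = pairTerm (C 1) m := by
  simp only [termAPrime, pairTerm, map_one, one_mul]
  ring

theorem termADoublePrime_eq (m : ℕ) : termADoublePrime m = pairTerm (C (-1)) m := by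
  simp only [termADoublePrime, pairTerm, map_neg, map_one, neg_one_mul]

end MainSeries

/-! ### Coefficients as finite signed sums -/

section Truncation

theorem X_pow_dvd_qPochInf_sub_one {N : ℕ} {a : ℤ⟦X⟧} (h : X ^ N ∣ a) :
    X ^ N ∣ qPochInf a - 1 := by
  rw [← tsum_eulerTerm, (summable_eulerTerm _).tsum_eq_zero_add]
  have h0 : eulerTerm a 0 = 1 := by simp [eulerTerm]
  rw [h0, add_sub_cancel_left]
  refine X_pow_dvd_tsum fun r => Dvd.dvd.mul_right (Dvd.dvd.mul_right ?_ _) _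
  exact ((dvd_neg.mpr h)).trans (dvd_pow_self _ r.succ_ne_zero)

/-- The finite product `∏ k ∈ I, (1 + w q ^ k)`. -/
noncomputable def signedProd (w : ℤ) (I : Finset ℕ) : ℤ⟦X⟧ := ∏ k ∈ I, (1 + C w * X ^ k)

theorem signedProd_eq_sum (w : ℤ) (I : Finset ℕ) :
    signedProd w I = ∑ S ∈ I.powerset, C (w ^ S.card) * X ^ (∑ k ∈ S, k) := by
  rw [signedProd, Finset.prod_one_add]
  refine Finset.sum_congr rfl fun S _ => ?_
  rw [Finset.prod_mul_distrib, Finset.prod_const, Finset.prod_pow_eq_pow_sum, map_pow]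

theorem qPoch_eq_signedProd (u : ℤ) (m N : ℕ) :
    qPoch (C u * X ^ m) N = signedProd (-u) (Finset.Ico m (m + N)) := by
  rw [signedProd, Finset.prod_Ico_eq_prod_range, Nat.add_sub_cancel_left, qPoch]
  refine Finset.prod_congr rfl fun k _ => ?_
  rw [map_neg, pow_add]
  ring

/-- The omitted tail starts at q^(m+1+n), so it is 1 modulo q^(n+1). -/
theorem X_pow_dvd_qPochInf_sub_signedProd (u : ℤ) (m n : ℕ) :
    X ^ (n + 1) ∣ qPochInf (C u * X ^ (m + 1)) -
      signedProd (-u) (Finset.Ico (m + 1) (m + 1 + n)) := by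
  rw [← qPoch_mul_qPochInf _ n, ← qPoch_eq_signedProd]
  have h : (X : ℤ⟦X⟧) ^ (n + 1) ∣ C u * X ^ (m + 1) * X ^ n := by
    rw [mul_assoc, ← pow_add]
    exact Dvd.dvd.mul_left (pow_dvd_pow _ (by omega)) _
  have := Dvd.dvd.mul_left (X_pow_dvd_qPochInf_sub_one h) (qPoch (C u * X ^ (m + 1)) n)
  rwa [mul_sub, mul_one] at this

theorem coeff_pairTerm (u : ℤ) (m n : ℕ) :
    coeff n (pairTerm (C u) m) =
      coeff n (X ^ m * (signedProd (-u) (Finset.Ico (m + 1) (m + 1 + n)) *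
        (signedProd (-1) (Finset.Ico (m + 1) (m + 1 + n)) *
        (signedProd (-u) (Finset.Ico (m + 1) (m + 1 + n)) *
        signedProd (-1) (Finset.Ico m (2 * m)))))) := by
  rw [← sub_eq_zero, ← map_sub]
  refine X_pow_dvd_iff.mp (?_ : X ^ (n + 1) ∣ _) n (Nat.lt_succ_self n)
  have h1 := X_pow_dvd_qPochInf_sub_signedProd u m n
  have h2 := X_pow_dvd_qPochInf_sub_signedProd 1 m n
  have h3 := qPoch_eq_signedProd 1 m m
  rw [map_one, one_mul] at h2 h3
  rw [← two_mul] at h3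
  rw [pairTerm, h3]
  -- Divisibility of differences becomes equality modulo q^(n+1), where each infinite product can be
  -- replaced by its truncation.
  rw [← Ideal.mem_span_singleton, ← Ideal.Quotient.eq] at *
  simp only [map_mul, map_pow, h1, h2]
  ring

/-- The index set for the expansion of `pairTerm`: the parts of `λ₁` other than the overlined
smallest part `m`, and those of `λ₂`. -/
def tupleSet (m n : ℕ) : Finset (Finset ℕ × Finset ℕ × Finset ℕ × Finset ℕ) :=
  ((Finset.Ico (m + 1) (m + 1 + n)).powerset ×ˢ (Finset.Ico (m + 1) (m + 1 + n)).powerset ×ˢ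
    (Finset.Ico (m + 1) (m + 1 + n)).powerset ×ˢ (Finset.Ico m (2 * m)).powerset).filter
    fun x => m + (∑ k ∈ x.1, k + (∑ k ∈ x.2.1, k + (∑ k ∈ x.2.2.1, k + ∑ k ∈ x.2.2.2, k))) = n

theorem coeff_pairTerm_eq_sum (u : ℤ) (m n : ℕ) :
    coeff n (pairTerm (C u) m) = ∑ x ∈ tupleSet m n,
      (-u) ^ x.1.card * ((-1) ^ x.2.1.card * ((-u) ^ x.2.2.1.card * (-1) ^ x.2.2.2.card)) := by
  rw [coeff_pairTerm]
  simp only [signedProd_eq_sum]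
  have H : ∀ {α β : Type} (s : Finset α) (t : Finset β) (f : α → ℤ⟦X⟧) (g : β → ℤ⟦X⟧),
      (∑ x ∈ s, f x) * ∑ y ∈ t, g y = ∑ z ∈ s ×ˢ t, f z.1 * g z.2 := fun s t f g =>
    (Finset.sum_mul_sum _ _ _ _).trans (Finset.sum_product' s t fun x y => f x * g y).symm
  rw [H, H, H, Finset.mul_sum, map_sum, tupleSet, Finset.sum_filter]
  refine Finset.sum_congr rfl fun x _ => ?_
  have hx : ∀ (a b c d : ℤ) (e f g h : ℕ), (X : ℤ⟦X⟧) ^ m * (C a * X ^ e * (C b * X ^ f *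
      (C c * X ^ g * (C d * X ^ h)))) = C (a * (b * (c * d))) * X ^ (m + (e + (f + (g + h)))) := by
    intro a b c d e f g h
    simp only [map_mul, pow_add]
    ring
  rw [hx, coeff_C_mul, coeff_X_pow]
  by_cases h : m + (∑ k ∈ x.1, k + (∑ k ∈ x.2.1, k + (∑ k ∈ x.2.2.1, k + ∑ k ∈ x.2.2.2, k))) = n
  · rw [if_pos h, if_pos h.symm, mul_one]
  · rw [if_neg h, if_neg (Ne.symm h), mul_zero]

theorem coeff_tsum_pairTerm_eq_sum (u : ℤ) (n : ℕ) (hs : Summable fun p => pairTerm (C u) (p + 1)) :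
    coeff n (∑' p, pairTerm (C u) (p + 1)) = ∑ m ∈ Finset.Icc 1 n, coeff n (pairTerm (C u) m) := by
  rw [coeff_tsum hs, tsum_eq_sum (s := Finset.range n)]
  · rw [Finset.range_eq_Ico, Finset.sum_Ico_add' (fun m => coeff n (pairTerm (C u) m)) 0 n 1]
    rfl
  · intro p hp
    refine X_pow_dvd_iff.mp (?_ : X ^ (p + 1) ∣ _) n (by simpa [Nat.lt_succ_iff] using hp)
    exact Dvd.dvd.mul_right (Dvd.dvd.mul_right (dvd_mul_right _ _) _) _

end Truncation

/-! ### Signed counts of overpartition pairs -/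

section Counting

theorem mem_pairsA_and_smallest_iff {n m : ℕ} (p : OverpartitionPair) :
    (p ∈ pairsA n ∧ OverpartitionPair.smallest p = m) ↔
      OverpartitionPair.size p = n ∧ p.1.plain.Nodup ∧ p.2.plain.Nodup ∧ m ∈ p.1.overlined ∧
      (∀ i ∈ p.1.overlined, m ≤ i) ∧ (∀ i ∈ p.1.plain, m < i) ∧ (∀ i ∈ p.2.overlined, m < i) ∧
      (∀ i ∈ p.2.plain, m ≤ i ∧ i < 2 * m) := by
  constructor
  · rintro ⟨⟨h1, ⟨h2, h3⟩, h4, h5, h6, h7, h8⟩, rfl⟩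
    refine ⟨h1, h2, h3, h5, fun i hi => ?_, h6, h7, h8⟩
    refine Nat.sInf_le ?_
    change i ∈ p.1.parts + p.2.parts
    simp only [Overpartition.parts, Multiset.mem_add, Finset.mem_val]
    exact Or.inl (Or.inl hi)
  · rintro ⟨h1, h2, h3, h5, h5', h6, h7, h8⟩
    have e1 : OverpartitionPair.smallest p = m := by
      refine IsLeast.csInf_eq ⟨?_, fun i hi => ?_⟩
      · change m ∈ p.1.parts + p.2.parts
        simp only [Overpartition.parts, Multiset.mem_add, Finset.mem_val]
        exact Or.inl (Or.inl h5)
      · change i ∈ p.1.parts + p.2.parts at hi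
        simp only [Overpartition.parts, Multiset.mem_add, Finset.mem_val] at hi
        rcases hi with (hi | hi) | (hi | hi)
        exacts [h5' i hi, (h6 i hi).le, (h7 i hi).le, (h8 i hi).1]
    have e2 : p.1.smallest = m := by
      refine IsLeast.csInf_eq ⟨?_, fun i hi => ?_⟩
      · change m ∈ p.1.parts
        simp only [Overpartition.parts, Multiset.mem_add, Finset.mem_val]
        exact Or.inl h5
      · change i ∈ p.1.parts at hi
        simp only [Overpartition.parts, Multiset.mem_add, Finset.mem_val] at hi
        rcases hi with hi | hi
        exacts [h5' i hi, (h6 i hi).le]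
    refine ⟨⟨h1, ⟨h2, h3⟩, ?_⟩, e1⟩
    rw [e1, e2]
    exact ⟨rfl, h5, h6, h7, h8⟩

theorem Overpartition.size_eq (l : Overpartition) :
    l.size = ∑ k ∈ l.overlined, k + l.plain.sum := by
  simp [Overpartition.size, Overpartition.parts]

theorem Overpartition.numParts_eq (l : Overpartition) :
    l.numParts = l.overlined.card + l.plain.card := by
  simp [Overpartition.numParts, Overpartition.parts]

theorem sum_toFinset_of_nodup {s : Multiset ℕ} (h : s.Nodup) : ∑ k ∈ s.toFinset, k = s.sum := by
  rw [Finset.sum_eq_multiset_sum, Multiset.toFinset_val, h.dedup, Multiset.map_id']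

/-- The overlined copy of m in the first component is forced: its size is the factor q^m of the term
and its weight is the extra -u on the right. -/
theorem sum_smallest_eq (u : ℤ) {n m : ℕ} (hm : 1 ≤ m) :
    ∑ p ∈ (pairsA_finite n).toFinset with OverpartitionPair.smallest p = m,
      (-u) ^ (p.1.overlined.card + p.2.overlined.card) * (-1) ^ OverpartitionPair.numPlain p =
      -u * coeff n (pairTerm (C u) m) := by
  rw [coeff_pairTerm_eq_sum, Finset.mul_sum]
  have hmem : ∀ p : OverpartitionPair,
      p ∈ (pairsA_finite n).toFinset.filter (fun p => OverpartitionPair.smallest p = m) ↔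
      OverpartitionPair.size p = n ∧ p.1.plain.Nodup ∧ p.2.plain.Nodup ∧ m ∈ p.1.overlined ∧
      (∀ i ∈ p.1.overlined, m ≤ i) ∧ (∀ i ∈ p.1.plain, m < i) ∧ (∀ i ∈ p.2.overlined, m < i) ∧
      (∀ i ∈ p.2.plain, m ≤ i ∧ i < 2 * m) := by
    intro p
    rw [Finset.mem_filter, Set.Finite.mem_toFinset, mem_pairsA_and_smallest_iff]
  -- Since parts are distinct, a pair is recorded by four sets: overlined and non-overlined parts of
  -- the first component, then of the second, with the forced m erased from the first set.
  refine Finset.sum_bij (fun p _ =>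
    (p.1.overlined.erase m, p.1.plain.toFinset, p.2.overlined, p.2.plain.toFinset)) ?_ ?_ ?_ ?_
  · intro p hp
    obtain ⟨h1, h2, h3, h4, h5, h6, h7, h8⟩ := (hmem p).mp hp
    have hle1 : ∀ i ∈ p.1.overlined, i ≤ ∑ k ∈ p.1.overlined, k := fun i hi =>
      Finset.single_le_sum (f := fun k => k) (fun _ _ => Nat.zero_le _) hi
    have hle2 : ∀ i ∈ p.1.plain, i ≤ p.1.plain.sum := fun i hi => Multiset.le_sum_of_mem hi
    have hle3 : ∀ i ∈ p.2.overlined, i ≤ ∑ k ∈ p.2.overlined, k := fun i hi =>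
      Finset.single_le_sum (f := fun k => k) (fun _ _ => Nat.zero_le _) hi
    rw [OverpartitionPair.size, Overpartition.size_eq, Overpartition.size_eq] at h1
    have hadd := Finset.add_sum_erase _ (fun k => k) h4
    simp only [tupleSet, Finset.mem_filter, Finset.mem_product, Finset.mem_powerset,
      sum_toFinset_of_nodup h2, sum_toFinset_of_nodup h3]
    refine ⟨⟨fun i hi => ?_, fun i hi => ?_, fun i hi => ?_, fun i hi => ?_⟩, by omega⟩
    · rw [Finset.mem_erase] at hi
      have := hle1 i hi.2
      have := h5 i hi.2
      have := hi.1
      rw [Finset.mem_Ico]; omega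
    · rw [Multiset.mem_toFinset] at hi
      have := hle2 i hi
      have := h6 i hi
      rw [Finset.mem_Ico]; omega
    · have := hle3 i hi
      have := h7 i hi
      rw [Finset.mem_Ico]; omega
    · rw [Multiset.mem_toFinset] at hi
      rw [Finset.mem_Ico]; exact h8 i hi
  · intro p hp r hr h
    obtain ⟨-, h2, h3, h4, -⟩ := (hmem p).mp hp
    obtain ⟨-, k2, k3, k4, -⟩ := (hmem r).mp hr
    simp only [Prod.mk.injEq] at h
    obtain ⟨e1, e2, e3, e4⟩ := h
    have key : ∀ s t : Multiset ℕ, s.Nodup → t.Nodup → s.toFinset = t.toFinset → s = t := by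
      intro s t hs ht hst
      have := congrArg Finset.val hst
      rwa [Multiset.toFinset_val, Multiset.toFinset_val, hs.dedup, ht.dedup] at this
    refine Prod.ext (Overpartition.ext ?_ (key _ _ h2 k2 e2)) (Overpartition.ext e3 (key _ _ h3 k3 e4))
    rw [← Finset.insert_erase h4, e1, Finset.insert_erase k4]
  · rintro ⟨S1, T1, S2, T2⟩ hx
    simp only [tupleSet, Finset.mem_filter, Finset.mem_product, Finset.mem_powerset] at hx
    obtain ⟨⟨h1, h2, h3, h4⟩, h5⟩ := hx
    have g1 : ∀ i ∈ S1, m < i := fun i hi => (Finset.mem_Ico.mp (h1 hi)).1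
    have g2 : ∀ i ∈ T1, m < i := fun i hi => (Finset.mem_Ico.mp (h2 hi)).1
    have g3 : ∀ i ∈ S2, m < i := fun i hi => (Finset.mem_Ico.mp (h3 hi)).1
    have g4 : ∀ i ∈ T2, m ≤ i ∧ i < 2 * m := fun i hi => Finset.mem_Ico.mp (h4 hi)
    have hnot : m ∉ S1 := fun h => lt_irrefl _ (g1 m h)
    refine ⟨(⟨insert m S1, T1.val, ?_, ?_⟩, ⟨S2, T2.val, ?_, ?_⟩), ?_, ?_⟩
    · intro i hi
      rcases Finset.mem_insert.mp hi with rfl | hi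
      · exact hm
      · exact (Nat.zero_le m).trans_lt (g1 i hi)
    · exact fun i hi => (Nat.zero_le m).trans_lt (g2 i hi)
    · exact fun i hi => (Nat.zero_le m).trans_lt (g3 i hi)
    · exact fun i hi => hm.trans (g4 i hi).1
    · rw [hmem]
      refine ⟨?_, T1.nodup, T2.nodup, Finset.mem_insert_self _ _, ?_, g2, g3, g4⟩
      · rw [OverpartitionPair.size, Overpartition.size_eq, Overpartition.size_eq]
        dsimp only
        rw [Finset.sum_insert hnot, Finset.sum_val, Finset.sum_val]
        simp only [id]
        omega
      · intro i hi
        rcases Finset.mem_insert.mp hi with rfl | hi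
        · exact le_rfl
        · exact (g1 i hi).le
    · simp [Finset.erase_insert hnot]
  · intro p hp
    obtain ⟨-, h2, h3, h4, -⟩ := (hmem p).mp hp
    dsimp only
    rw [Multiset.toFinset_card_of_nodup h2, Multiset.toFinset_card_of_nodup h3,
      ← Finset.card_erase_add_one h4, OverpartitionPair.numPlain]
    ring

theorem sum_pairsA_eq (u : ℤ) (n : ℕ)
    (hs : Summable fun p => pairTerm (C u) (p + 1)) :
    ∑ p ∈ (pairsA_finite n).toFinset,
      (-u) ^ (p.1.overlined.card + p.2.overlined.card) * (-1) ^ OverpartitionPair.numPlain p =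
      -u * coeff n (∑' p, pairTerm (C u) (p + 1)) := by
  rw [coeff_tsum_pairTerm_eq_sum u n hs, Finset.mul_sum]
  -- The pairs are sorted by smallest part, which lies between 1 and n.
  rw [← Finset.sum_fiberwise_of_maps_to (t := Finset.Icc 1 n) (g := OverpartitionPair.smallest)]
  · exact Finset.sum_congr rfl fun m hm => sum_smallest_eq u (Finset.mem_Icc.mp hm).1
  · intro p hp
    obtain ⟨h1, -, -, h4, -⟩ :=
      (mem_pairsA_and_smallest_iff p).mp ⟨(pairsA_finite n).mem_toFinset.mp hp, rfl⟩
    have := Finset.single_le_sum (f := fun k => k) (fun _ _ => Nat.zero_le _) h4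
    rw [OverpartitionPair.size, Overpartition.size_eq] at h1
    have := p.1.overlined_pos _ h4
    rw [Finset.mem_Icc]
    omega

theorem ncard_even_eq_ncard_odd {α : Type*} {s : Set α} (hs : s.Finite) (f : α → ℕ)
    (h : ∑ x ∈ hs.toFinset, (-1 : ℤ) ^ f x = 0) :
    {x ∈ s | Even (f x)}.ncard = {x ∈ s | Odd (f x)}.ncard := by
  classical
  have h1 : {x ∈ s | Even (f x)} = ↑(hs.toFinset.filter fun x => Even (f x)) := by ext; simp
  have h2 : {x ∈ s | Odd (f x)} = ↑(hs.toFinset.filter fun x => ¬ Even (f x)) := by ext; simp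
  rw [h1, h2, Set.ncard_coe_finset, Set.ncard_coe_finset]
  rw [← Finset.sum_filter_add_sum_filter_not _ fun x => Even (f x)] at h
  rw [Finset.sum_congr rfl (g := fun _ => (1 : ℤ)) fun x hx => (Finset.mem_filter.mp hx).2.neg_one_pow,
    Finset.sum_congr (s₁ := hs.toFinset.filter fun x => ¬ Even (f x)) rfl (g := fun _ => (-1 : ℤ))
      fun x hx => (Nat.not_even_iff_odd.mp (Finset.mem_filter.mp hx).2).neg_one_pow] at h
  simp only [Finset.sum_const, nsmul_eq_mul, mul_one] at h
  have : ((hs.toFinset.filter fun x => Even (f x)).card : ℤ) =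
      (hs.toFinset.filter fun x => ¬ Even (f x)).card := by linarith
  exact_mod_cast this

end Counting

end OverpartitionPairs

open OverpartitionPairs in
theorem mainTheorem7 (n : ℕ) (hn : 0 < n) (htri : ¬ ∃ k : ℕ, n = k * (k + 1) / 2) :
    (OverpartitionPairs.APrime n = 0 ∧ OverpartitionPairs.ADoublePrime n = 0) ∧
      OverpartitionPairs.A0 n = OverpartitionPairs.A1 n ∧
      OverpartitionPairs.A2 n = OverpartitionPairs.A3 n := by
  have z1 := coeff_tsum_pairTerm 1 (by norm_num) htri
  have z2 := coeff_tsum_pairTerm (-1) (by norm_num) htri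
  have s1 := summable_termAPrime
  have s2 := summable_termADoublePrime
  simp only [termAPrime_eq] at s1
  simp only [termADoublePrime_eq] at s2
  refine ⟨⟨?_, ?_⟩, ?_, ?_⟩
  · simpa only [APrime, termAPrime_eq] using z1
  · simpa only [ADoublePrime, termADoublePrime_eq] using z2
  · refine ncard_even_eq_ncard_odd (pairsA_finite n) _ ?_
    have h := sum_pairsA_eq 1 n s1
    rw [z1, mul_zero] at h
    -- For u = 1 every part has weight -1, so the exponents add up to the number of parts.
    rw [← h]
    refine Finset.sum_congr rfl fun p _ => ?_
    rw [← pow_add, OverpartitionPair.numParts, OverpartitionPair.numPlain,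
      Overpartition.numParts_eq, Overpartition.numParts_eq]
    congr 1
    omega
  · refine ncard_even_eq_ncard_odd (pairsA_finite n) _ ?_
    have h := sum_pairsA_eq (-1) n s2
    rw [z2, mul_zero] at h
    rw [← h]
    -- For u = -1 overlined parts have weight 1 and only non-overlined parts are signed.
    exact Finset.sum_congr rfl fun p _ => by rw [neg_neg, one_pow, one_mul]
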